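/- For a real $n\times n$ matrix $M$ let $\sigma(M)\subset\mathbb C$ be its set of complex eigenvalues and $\rho(M)=\max\{|\lambda|:\lambda\in\sigma(M)\}$ its spectral radius; $M$ is called strictly positive stable if $\operatorname{Re}\lambda>0$ for all $\lambda\in\sigma(M)$. For matrices and vectors, $\ge 0$ (resp. $>0$) means that all entries are nonnegative (resp. positive). $\langle\cdot,\cdot\rangle$ and $\|\cdot\|$ denote the Euclidean inner product and norm on $\mathbb R^n$. **Theorem 2.7.** Let $H=(h_{ij})\in\mathbb R^{n\times n}$, $H\ge 0$, and let $A=\rho(H)I-H$ (a singular M-matrix). Suppose that $0$ is a geometrically simple eigenvalue of $A$, and let $z_\ell,z_r\in\mathbb R^n$ be nonzero vectors with $z_\ell^TA=0$ and $Az_r=0$. Let $v,w\in\mathbb R^n$ satisfy $(z_\ell^Tv)(w^Tz_r)\ne 0$. Then $A+vw^T$ is strictly positive stable in any of the following cases: (i) $n=2$, $v,w\ge 0$, and at least one of the following holds: (a) the eigenvalue $0$ of $A$ is algebraically simple; (b) $w^Tv>0$. (ii) $Av=0$ or $w^TA=0$; and $w^Tv>0$. (iii) $A$ is normal and $w=v$.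 (iv) $v,w>0$ and $2h_{ij}\ge v_iw_j$ for all $i,j$. (v) There is a matrix $K=(k_{ij})\in\mathbb R^{n\times n}$, $K\ge 0$, such that $|h_{ij}-v_iw_j|\le k_{ij}$ for all $i,j$ and $$\rho(K)+h_{ii}<\rho(H)+k_{ii}+v_iw_i\qquad\text{for all } i=1,\dots,n.$$ (vi) $A$ is symmetric and, for some nonzero $z\in\mathbb R^n$ with $Az=0$, the vectors $v$ and $w$ are not both scalar multiples of $z$, $\langle v,z\rangle\langle w,z\rangle>0$, and $$\frac{\|v\|\,\|w\|}{2}<\Big(\frac{\alpha}{1-\alpha}\Big)^{1/2}\tau,\qquad \tau=\min\{\mu\in\sigma(A):\mu\ne0\},\qquad \alpha=\frac{|\langle v,z\rangle\langle w,z\rangle|}{\|v\|\,\|w\|\,\|z\|^2}.$$ If $v,w\ge 0$, the conditions $w^Tv>0$ in (ii) and $\langle v,z\rangle\langle w,z\rangle>0$ in (vi) hold automatically. -/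

import Mathlib

open scoped Matrix

namespace RankOnePerturbation

noncomputable section

/-- The spectral radius of a real square matrix: the largest modulus of its complex eigenvalues. -/
def specRadius {n : ℕ} (M : Matrix (Fin n) (Fin n) ℝ) : ℝ :=
  (spectralRadius ℂ (M.map (fun x : ℝ => (x : ℂ)))).toReal

/-- A real square matrix is strictly positive stable if all its complex eigenvalues have positive
real part. -/
def StrictlyPositiveStable {n : ℕ} (M : Matrix (Fin n) (Fin n) ℝ) : Prop :=
  ∀ μ ∈ spectrum ℂ (M.map (fun x : ℝ => (x : ℂ))), 0 < μ.re

/-- `0` is a geometrically simple eigenvalue: the null space of `M` is one-dimensional. -/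
def ZeroGeomSimple {n : ℕ} (M : Matrix (Fin n) (Fin n) ℝ) : Prop :=
  Module.finrank ℝ (LinearMap.ker M.mulVecLin) = 1

/-- `0` is an algebraically simple eigenvalue: it is a simple root of the characteristic
polynomial. -/
def ZeroAlgSimple {n : ℕ} (M : Matrix (Fin n) (Fin n) ℝ) : Prop :=
  M.charpoly.rootMultiplicity 0 = 1

/-- The Euclidean norm of a vector in `ℝⁿ`. -/
def euclNorm {n : ℕ} (x : Fin n → ℝ) : ℝ :=
  ‖(WithLp.toLp 2 x : EuclideanSpace ℝ (Fin n))‖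

/-- `x` is parallel to `z`. -/
def Parallel {n : ℕ} (x z : Fin n → ℝ) : Prop :=
  ∃ c : ℝ, x = c • z

/-- The number `α = |⟨v, z⟩ ⟨w, z⟩| / (‖v‖ ‖w‖ ‖z‖²)`. -/
def alpha {n : ℕ} (v w z : Fin n → ℝ) : ℝ :=
  |(v ⬝ᵥ z) * (w ⬝ᵥ z)| / (euclNorm v * euclNorm w * euclNorm z ^ 2)

end

end RankOnePerturbation

/-!
Let `r = ρ(H)`, `A = r I - H` and `B = A + v wᵀ`. An eigenvalue of `A` is `r - λ` with `|λ| ≤ r`,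
so it has positive real part unless it is `0` (`eigenvalue_eq_zero_of_re_nonpos`). Since
`(zlᵀ v) (wᵀ zr) ≠ 0`, the perturbation `B` is nonsingular
(`eq_zero_of_perturbed_mulVec_eq_zero`). So if `B x = μ x` with `Re μ ≤ 0`, then `μ ≠ 0` and
`wᵀ x ≠ 0`. Each case excludes such a `μ`.

* For `n = 2`, trace and determinant of `B` are positive.
* If `A v = 0` or `wᵀ A = 0`, then `μ` is either an eigenvalue of `A` or equal to `wᵀ v`.
* If `A` is normal, so is `H`, and its Euclidean operator norm is `r`. Hence `Re (x* A x) ≥ 0`, and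
  `v = w` adds the positive term `|wᵀ x|²`.
* The two cases with entrywise bounds concern eigenvalues `r - μ` of `H - v wᵀ`. They rest on a form
  of Ky Fan's theorem (`exists_norm_sub_diag_le`), which follows from the Collatz–Wielandt bound
  (`le_specRadius_of_smul_le_mulVec`), itself a consequence of Gelfand's formula: no Perron vector
  is needed.
* If `A` is symmetric with kernel spanned by `z`, it is bounded below by `τ` on the complement of
  `z`. Eliminating the component of `x` orthogonal to `z` gives `τ ≤ ‖v‖‖w‖ (1 - 2α)`
  (`le_norm_mul_norm_sub_of_eigenvalue`), which contradicts the hypothesis because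
  `4 α (1 - 2α)² ≤ 1 - α` for `0 < α < 1/2` (`sub_lt_of_half_lt_sqrt_mul`).
-/

namespace RankOnePerturbation

/-! ### Complexification -/

/-- The real matrix `M`, viewed as a complex matrix. -/
abbrev complexMatrix {n : ℕ} (M : Matrix (Fin n) (Fin n) ℝ) : Matrix (Fin n) (Fin n) ℂ :=
  M.map (fun x : ℝ => (x : ℂ))

/-- The real vector `x`, viewed as a complex vector. -/
abbrev complexVec {n : ℕ} (x : Fin n → ℝ) : Fin n → ℂ := fun i => (x i : ℂ)

variable {n : ℕ}

theorem complexVec_apply (x : Fin n → ℝ) (i : Fin n) : complexVec x i = (x i : ℂ) := rfl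

theorem complexMatrix_pow (M : Matrix (Fin n) (Fin n) ℝ) (m : ℕ) :
    complexMatrix (M ^ m) = complexMatrix M ^ m :=
  map_pow (Complex.ofRealHom.mapMatrix) M m

theorem complexMatrix_mulVec_complexVec (M : Matrix (Fin n) (Fin n) ℝ) (y : Fin n → ℝ) :
    complexMatrix M *ᵥ complexVec y = complexVec (M *ᵥ y) := by
  funext i
  simp [complexVec_apply, Matrix.mulVec, dotProduct]

theorem complexVec_dotProduct (x y : Fin n → ℝ) :
    complexVec x ⬝ᵥ complexVec y = ((x ⬝ᵥ y : ℝ) : ℂ) := by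
  simp [dotProduct]

theorem complexMatrix_mulVec_re (M : Matrix (Fin n) (Fin n) ℝ) (x : Fin n → ℂ) (i : Fin n) :
    ((complexMatrix M *ᵥ x) i).re = (M *ᵥ fun j => (x j).re) i := by
  simp [Matrix.mulVec, dotProduct]

theorem complexMatrix_mulVec_im (M : Matrix (Fin n) (Fin n) ℝ) (x : Fin n → ℂ) (i : Fin n) :
    ((complexMatrix M *ᵥ x) i).im = (M *ᵥ fun j => (x j).im) i := by
  simp [Matrix.mulVec, dotProduct]

theorem complexVec_dotProduct_mulVec (M : Matrix (Fin n) (Fin n) ℝ) (u : Fin n → ℝ)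
    (x : Fin n → ℂ) :
    complexVec u ⬝ᵥ (complexMatrix M *ᵥ x) = complexVec (u ᵥ* M) ⬝ᵥ x := by
  rw [Matrix.dotProduct_mulVec]
  congr 1
  funext i
  simp [complexVec_apply, Matrix.vecMul, dotProduct]

theorem complexMatrix_add_vecMulVec_mulVec (M : Matrix (Fin n) (Fin n) ℝ) (v w : Fin n → ℝ)
    (x : Fin n → ℂ) :
    complexMatrix (M + Matrix.vecMulVec v w) *ᵥ x
      = complexMatrix M *ᵥ x + (complexVec w ⬝ᵥ x) • complexVec v := by
  funext i
  simp only [Matrix.mulVec, dotProduct, Matrix.map_apply, Matrix.add_apply, Matrix.vecMulVec_apply,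
    Pi.add_apply, Pi.smul_apply, smul_eq_mul, Finset.sum_mul, ← Finset.sum_add_distrib]
  refine Finset.sum_congr rfl fun j _ => ?_
  push_cast
  ring

theorem complexMatrix_smul_one_sub_mulVec (r : ℝ) (M : Matrix (Fin n) (Fin n) ℝ)
    (x : Fin n → ℂ) :
    complexMatrix (r • (1 : Matrix (Fin n) (Fin n) ℝ) - M) *ᵥ x
      = (r : ℂ) • x - complexMatrix M *ᵥ x := by
  have : complexMatrix (r • (1 : Matrix (Fin n) (Fin n) ℝ) - M)
      = (r : ℂ) • (1 : Matrix (Fin n) (Fin n) ℂ) - complexMatrix M := by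
    ext i j
    by_cases h : i = j <;> simp [h]
  rw [this, Matrix.sub_mulVec, Matrix.smul_mulVec, Matrix.one_mulVec]

/-! ### Eigenvectors and the spectral radius -/

theorem mem_spectrum_iff_exists_mulVec {K : Type*} [Field K] (M : Matrix (Fin n) (Fin n) K)
    (μ : K) : μ ∈ spectrum K M ↔ ∃ x : Fin n → K, x ≠ 0 ∧ M *ᵥ x = μ • x := by
  rw [spectrum.mem_iff, Matrix.isUnit_iff_isUnit_det, isUnit_iff_ne_zero, not_not,
    ← Matrix.exists_mulVec_eq_zero_iff]
  refine exists_congr fun x => and_congr_right fun _ => ?_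
  rw [Matrix.sub_mulVec, Algebra.algebraMap_eq_smul_one, Matrix.smul_mulVec, Matrix.one_mulVec,
    sub_eq_zero, eq_comm]

theorem strictlyPositiveStable_of_eigenvector {M : Matrix (Fin n) (Fin n) ℝ}
    (h : ∀ (μ : ℂ) (x : Fin n → ℂ), x ≠ 0 → complexMatrix M *ᵥ x = μ • x → 0 < μ.re) :
    StrictlyPositiveStable M := fun μ hμ => by
  obtain ⟨x, hx, hMx⟩ := (mem_spectrum_iff_exists_mulVec _ _).1 hμ
  exact h μ x hx hMx

theorem specRadius_nonneg (M : Matrix (Fin n) (Fin n) ℝ) : 0 ≤ specRadius M :=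
  ENNReal.toReal_nonneg

section
attribute [local instance] Matrix.linftyOpNormedRing Matrix.linftyOpNormedAlgebra

theorem spectralRadius_complexMatrix_ne_top (M : Matrix (Fin n) (Fin n) ℝ) :
    spectralRadius ℂ (complexMatrix M) ≠ ⊤ := by
  refine ne_top_of_le_ne_top (b := ((‖complexMatrix M‖₊ * ‖(1 : Matrix (Fin n) (Fin n) ℂ)‖₊ :
    NNReal) : ENNReal)) ENNReal.coe_ne_top ?_
  refine iSup₂_le fun μ hμ => ?_
  exact_mod_cast spectrum.norm_le_norm_mul_of_mem hμ

theorem norm_le_specRadius {M : Matrix (Fin n) (Fin n) ℝ} {μ : ℂ} {x : Fin n → ℂ} (hx : x ≠ 0)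
    (hMx : complexMatrix M *ᵥ x = μ • x) : ‖μ‖ ≤ specRadius M := by
  have hμ : μ ∈ spectrum ℂ (complexMatrix M) := (mem_spectrum_iff_exists_mulVec _ _).2 ⟨x, hx, hMx⟩
  have h : (‖μ‖₊ : ENNReal) ≤ spectralRadius ℂ (complexMatrix M) :=
    le_iSup₂ (f := fun (k : ℂ) (_ : k ∈ spectrum ℂ (complexMatrix M)) => (‖k‖₊ : ENNReal)) μ hμ
  simpa [specRadius] using ENNReal.toReal_mono (spectralRadius_complexMatrix_ne_top M) h

theorem pow_mul_le_pow_mulVec {K : Matrix (Fin n) (Fin n) ℝ} (hK : ∀ i j, 0 ≤ K i j)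
    {y : Fin n → ℝ} {s : ℝ} (hs : 0 ≤ s) (h : ∀ i, s * y i ≤ (K *ᵥ y) i) (m : ℕ) (i : Fin n) :
    s ^ m * y i ≤ ((K ^ m) *ᵥ y) i := by
  induction m generalizing i with
  | zero => simp
  | succ m ih =>
    rw [pow_succ' K, ← Matrix.mulVec_mulVec]
    calc s ^ (m + 1) * y i = s ^ m * (s * y i) := by ring
      _ ≤ s ^ m * (K *ᵥ y) i := by gcongr; exact h i
      _ = (K *ᵥ fun j => s ^ m * y j) i := by
        simp only [Matrix.mulVec, dotProduct, Finset.mul_sum]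
        exact Finset.sum_congr rfl fun j _ => by ring
      _ ≤ _ := by
        simp only [Matrix.mulVec, dotProduct]
        exact Finset.sum_le_sum fun j _ => mul_le_mul_of_nonneg_left (ih j) (hK i j)

/-- The Collatz–Wielandt lower bound for the spectral radius of a nonnegative matrix. If `t` lies
strictly between the spectral radius and `s`, then `‖K ^ m‖ < t ^ m` for large `m` by Gelfand's
formula, which the growth `K ^ m y ≥ s ^ m y` rules out. -/
theorem le_specRadius_of_smul_le_mulVec {K : Matrix (Fin n) (Fin n) ℝ} (hK : ∀ i j, 0 ≤ K i j)
    {y : Fin n → ℝ} (hy : ∀ i, 0 ≤ y i) (hy0 : y ≠ 0) {s : ℝ}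
    (h : ∀ i, s * y i ≤ (K *ᵥ y) i) : s ≤ specRadius K := by
  by_contra! hlt
  obtain ⟨t, hρt, hts⟩ := exists_between hlt
  have ht : 0 < t := (specRadius_nonneg K).trans_lt hρt
  obtain ⟨i, hi⟩ : ∃ i, y i ≠ 0 := Function.ne_iff.1 hy0
  have hyi : 0 < y i := (hy i).lt_of_ne' hi
  have hlim := spectrum.pow_nnnorm_pow_one_div_tendsto_nhds_spectralRadius (complexMatrix K)
  have hρt' : spectralRadius ℂ (complexMatrix K) < ENNReal.ofReal t :=
    (ENNReal.lt_ofReal_iff_toReal_lt (spectralRadius_complexMatrix_ne_top K)).2 hρt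
  have hev := (hlim.eventually_lt_const hρt').and (Filter.eventually_gt_atTop 0)
  have hbig := (tendsto_pow_atTop_atTop_of_one_lt ((one_lt_div ht).2 hts)).eventually_gt_atTop
    (‖complexVec y‖ / y i)
  obtain ⟨m, ⟨hm, hm0⟩, hm'⟩ := (hev.and hbig).exists
  have hnorm : ‖complexMatrix K ^ m‖ ≤ t ^ m := by
    have h1 : ((‖complexMatrix K ^ m‖₊ : ENNReal) ^ (1 / m : ℝ)) ^ (m : ℝ)
        ≤ (ENNReal.ofReal t) ^ (m : ℝ) := ENNReal.rpow_le_rpow hm.le (by positivity)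
    rw [← ENNReal.rpow_mul, one_div, inv_mul_cancel₀ (by positivity), ENNReal.rpow_one,
      ENNReal.rpow_natCast, ← ENNReal.ofReal_pow ht.le] at h1
    have h2 := ENNReal.toReal_mono ENNReal.ofReal_ne_top h1
    rwa [ENNReal.toReal_ofReal (by positivity), ENNReal.coe_toReal, coe_nnnorm] at h2
  have h1 : s ^ m * y i ≤ t ^ m * ‖complexVec y‖ := calc
    s ^ m * y i ≤ ((K ^ m) *ᵥ y) i := pow_mul_le_pow_mulVec hK (ht.trans hts).le h m i
    _ ≤ ‖complexVec ((K ^ m) *ᵥ y) i‖ := by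
      rw [Complex.norm_real]; exact le_abs_self _
    _ ≤ ‖complexVec ((K ^ m) *ᵥ y)‖ := norm_le_pi_norm _ i
    _ = ‖complexMatrix K ^ m *ᵥ complexVec y‖ := by
      rw [← complexMatrix_mulVec_complexVec, complexMatrix_pow]
    _ ≤ ‖complexMatrix K ^ m‖ * ‖complexVec y‖ := Matrix.linfty_opNorm_mulVec _ _
    _ ≤ t ^ m * ‖complexVec y‖ := by gcongr
  rw [div_pow, div_lt_div_iff₀ hyi (by positivity)] at hm'
  linarith

end

/-- A form of Ky Fan's theorem on eigenvalue inclusion discs: if `K` dominates `C` entrywise in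
modulus, some diagonal entry of `C` lies within `ρ(K) - kᵢᵢ` of each eigenvalue of `C`.
The vector of moduli of an eigenvector is the test vector for the Collatz–Wielandt bound. -/
theorem exists_norm_sub_diag_le {C K : Matrix (Fin n) (Fin n) ℝ}
    (hCK : ∀ i j, |C i j| ≤ K i j) {μ : ℂ} {x : Fin n → ℂ} (hx : x ≠ 0)
    (hCx : complexMatrix C *ᵥ x = μ • x) :
    ∃ i, ‖μ - C i i‖ + K i i ≤ specRadius K := by
  by_contra! hlt
  have hK : ∀ i j, 0 ≤ K i j := fun i j => (abs_nonneg _).trans (hCK i j)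
  have hne : (Finset.univ : Finset (Fin n)).Nonempty := by
    obtain ⟨i, -⟩ := Function.ne_iff.1 hx
    exact ⟨i, Finset.mem_univ i⟩
  obtain ⟨i₀, -, hi₀⟩ := Finset.exists_min_image Finset.univ (fun i => ‖μ - C i i‖ + K i i) hne
  refine (hlt i₀).not_ge (le_specRadius_of_smul_le_mulVec hK (y := fun i => ‖x i‖)
    (fun i => norm_nonneg _) (fun h => hx ?_) fun i => ?_)
  · funext i
    simpa using congrFun h i
  · have h1 : (μ - C i i) * x i = ∑ j ∈ Finset.univ.erase i, (C i j : ℂ) * x j := by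
      have h2 := congrFun hCx i
      simp only [Matrix.mulVec, dotProduct, Matrix.map_apply, Pi.smul_apply, smul_eq_mul] at h2
      rw [← Finset.add_sum_erase _ _ (Finset.mem_univ i)] at h2
      rw [sub_mul, ← h2]
      ring
    have h3 : ‖μ - C i i‖ * ‖x i‖ ≤ ∑ j ∈ Finset.univ.erase i, K i j * ‖x j‖ := by
      rw [← norm_mul, h1]
      refine (norm_sum_le _ _).trans (Finset.sum_le_sum fun j _ => ?_)
      rw [norm_mul, Complex.norm_real]
      exact mul_le_mul_of_nonneg_right (hCK i j) (norm_nonneg _)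
    calc (‖μ - C i₀ i₀‖ + K i₀ i₀) * ‖x i‖ ≤ (‖μ - C i i‖ + K i i) * ‖x i‖ :=
          mul_le_mul_of_nonneg_right (hi₀ i (Finset.mem_univ i)) (norm_nonneg _)
      _ ≤ K i i * ‖x i‖ + ∑ j ∈ Finset.univ.erase i, K i j * ‖x j‖ := by linarith
      _ = _ := Finset.add_sum_erase _ (fun j => K i j * ‖x j‖) (Finset.mem_univ i)

theorem diag_le_specRadius {K : Matrix (Fin n) (Fin n) ℝ} (hK : ∀ i j, 0 ≤ K i j) (i : Fin n) :
    K i i ≤ specRadius K := by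
  refine le_specRadius_of_smul_le_mulVec hK (y := Pi.single i 1) (fun j => ?_) (by simp)
    fun j => ?_
  · by_cases h : j = i <;> simp [h]
  · by_cases h : j = i
    · subst h; simp
    · simpa [h] using hK j i

/-! ### Eigenvalues of the singular M-matrix and of its perturbation -/

/-- An eigenvalue `ρ - μ` of `ρ(H) I - H` has `|μ| ≤ ρ`, so it lies in a disc of the right
half-plane that touches the imaginary axis only at `0`. -/
theorem eq_zero_of_norm_sub_le {r : ℝ} (hr : 0 ≤ r) {μ : ℂ} (h : ‖(r : ℂ) - μ‖ ≤ r)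
    (hre : μ.re ≤ 0) : μ = 0 := by
  have h1 : ‖(r : ℂ) - μ‖ ^ 2 ≤ r ^ 2 := by gcongr
  rw [Complex.sq_norm, Complex.normSq_apply] at h1
  simp only [Complex.sub_re, Complex.sub_im, Complex.ofReal_re, Complex.ofReal_im] at h1
  have h2 : 0 ≤ r * -μ.re := mul_nonneg hr (by linarith)
  have hre0 : μ.re = 0 := by
    have : μ.re ^ 2 = 0 := by nlinarith [sq_nonneg μ.re, sq_nonneg μ.im]
    simpa using this
  have him0 : μ.im = 0 := by
    have : μ.im ^ 2 = 0 := by nlinarith [sq_nonneg μ.re, sq_nonneg μ.im]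
    simpa using this
  exact Complex.ext hre0 him0

theorem eigenvalue_eq_zero_of_re_nonpos {H : Matrix (Fin n) (Fin n) ℝ} {μ : ℂ} {x : Fin n → ℂ}
    (hx : x ≠ 0)
    (hAx : complexMatrix (specRadius H • (1 : Matrix (Fin n) (Fin n) ℝ) - H) *ᵥ x = μ • x)
    (hre : μ.re ≤ 0) : μ = 0 := by
  rw [complexMatrix_smul_one_sub_mulVec] at hAx
  refine eq_zero_of_norm_sub_le (specRadius_nonneg H) (norm_le_specRadius (M := H) hx ?_) hre
  rw [sub_smul, ← hAx, sub_sub_cancel]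

theorem exists_smul_eq_of_mulVec_eq_zero {A : Matrix (Fin n) (Fin n) ℝ} (hgeom : ZeroGeomSimple A)
    {z : Fin n → ℝ} (hz : z ≠ 0) (hAz : A *ᵥ z = 0) {y : Fin n → ℝ} (hy : A *ᵥ y = 0) :
    ∃ c : ℝ, c • z = y := by
  obtain ⟨c, hc⟩ := (finrank_eq_one_iff_of_nonzero' (⟨z, hAz⟩ : LinearMap.ker A.mulVecLin)
    (fun h => hz (congrArg Subtype.val h))).1 hgeom ⟨y, hy⟩
  exact ⟨c, congrArg Subtype.val hc⟩

theorem eq_zero_of_perturbed_mulVec_eq_zero {A : Matrix (Fin n) (Fin n) ℝ}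
    (hgeom : ZeroGeomSimple A) {zl zr v w : Fin n → ℝ} (hzlA : zl ᵥ* A = 0) (hzr : zr ≠ 0)
    (hAzr : A *ᵥ zr = 0) (hnzp : (zl ⬝ᵥ v) * (w ⬝ᵥ zr) ≠ 0) {x : Fin n → ℂ}
    (hx : complexMatrix A *ᵥ x + (complexVec w ⬝ᵥ x) • complexVec v = 0) : x = 0 := by
  have hwx : complexVec w ⬝ᵥ x = 0 := by
    have h := congrArg (complexVec zl ⬝ᵥ ·) hx
    simp only [dotProduct_add, complexVec_dotProduct_mulVec, hzlA, dotProduct_smul,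
      complexVec_dotProduct, dotProduct_zero, smul_eq_mul] at h
    have h0 : complexVec (0 : Fin n → ℝ) ⬝ᵥ x = 0 := by
      simp [complexVec_apply, dotProduct]
    rw [h0, zero_add] at h
    refine (mul_eq_zero.1 h).resolve_right ?_
    exact_mod_cast left_ne_zero_of_mul hnzp
  rw [hwx, zero_smul, add_zero] at hx
  obtain ⟨a, ha⟩ := exists_smul_eq_of_mulVec_eq_zero hgeom hzr hAzr (y := fun j => (x j).re) <| by
    funext i; rw [← complexMatrix_mulVec_re, hx]; rfl
  obtain ⟨b, hb⟩ := exists_smul_eq_of_mulVec_eq_zero hgeom hzr hAzr (y := fun j => (x j).im) <| by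
    funext i; rw [← complexMatrix_mulVec_im, hx]; rfl
  have hxz : x = (⟨a, b⟩ : ℂ) • complexVec zr := by
    funext i
    have h1 := congrFun ha i
    have h2 := congrFun hb i
    simp only [Pi.smul_apply, smul_eq_mul] at h1 h2
    apply Complex.ext <;> simp [← h1, ← h2]
  rw [hxz, dotProduct_smul, complexVec_dotProduct, smul_eq_mul] at hwx
  have hc : (⟨a, b⟩ : ℂ) = 0 := by
    refine (mul_eq_zero.1 hwx).resolve_right ?_
    exact_mod_cast right_ne_zero_of_mul hnzp
  rw [hxz, hc, zero_smul]

/-! ### Two-by-two matrices -/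

theorem strictlyPositiveStable_fin_two {M : Matrix (Fin 2) (Fin 2) ℝ} (htr : 0 < M.trace)
    (hdet : 0 < M.det) : StrictlyPositiveStable M := by
  refine strictlyPositiveStable_of_eigenvector fun μ x hx hMx => ?_
  have h0 : (complexMatrix M - μ • (1 : Matrix (Fin 2) (Fin 2) ℂ)).det = 0 := by
    rw [← Matrix.exists_mulVec_eq_zero_iff]
    exact ⟨x, hx, by rw [Matrix.sub_mulVec, Matrix.smul_mulVec, Matrix.one_mulVec, hMx, sub_self]⟩
  rw [Matrix.det_fin_two] at h0 hdet
  rw [Matrix.trace_fin_two] at htr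
  have hre := congrArg Complex.re h0
  have him := congrArg Complex.im h0
  simp at hre him
  set t := M 0 0 + M 1 1 with ht
  have him' : μ.im * (2 * μ.re - t) = 0 := by rw [ht]; linarith
  rcases mul_eq_zero.1 him' with h | h
  · rw [h] at hre
    by_contra! hneg
    nlinarith [mul_nonneg htr.le (neg_nonneg.2 hneg), sq_nonneg μ.re]
  · linarith

theorem strictlyPositiveStable_fin_two_perturbed {H A : Matrix (Fin 2) (Fin 2) ℝ}
    (hH : ∀ i j, 0 ≤ H i j)
    (hA : A = specRadius H • (1 : Matrix (Fin 2) (Fin 2) ℝ) - H) (hsing : A.det = 0)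
    {v w : Fin 2 → ℝ} (hv : ∀ i, 0 ≤ v i) (hw : ∀ i, 0 ≤ w i)
    (hnonsing : (A + Matrix.vecMulVec v w).det ≠ 0) (h : ZeroAlgSimple A ∨ 0 < w ⬝ᵥ v) :
    StrictlyPositiveStable (A + Matrix.vecMulVec v w) := by
  set r := specRadius H with hr
  have h0 : 0 ≤ r - H 0 0 := sub_nonneg.2 (diag_le_specRadius hH 0)
  have h1 : 0 ≤ r - H 1 1 := sub_nonneg.2 (diag_le_specRadius hH 1)
  have htrA : A.trace = (r - H 0 0) + (r - H 1 1) := by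
    rw [hA, Matrix.trace_fin_two]; simp
  have hvw : w ⬝ᵥ v = w 0 * v 0 + w 1 * v 1 := by simp [dotProduct, Fin.sum_univ_two]
  have hvw0 : 0 ≤ w ⬝ᵥ v := by
    rw [hvw]; exact add_nonneg (mul_nonneg (hw 0) (hv 0)) (mul_nonneg (hw 1) (hv 1))
  apply strictlyPositiveStable_fin_two
  · rw [Matrix.trace_add, Matrix.trace_vecMulVec, dotProduct_comm]
    rcases h with h | h
    · have hne : A.trace ≠ 0 := fun htr => by
        have hchar : A.charpoly = Polynomial.X ^ 2 := by
          rw [Matrix.charpoly_fin_two, htr, hsing]; simp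
        unfold ZeroAlgSimple at h
        rw [hchar, ← Polynomial.count_roots] at h
        simp at h
      have : 0 < A.trace := lt_of_le_of_ne (by rw [htrA]; linarith) hne.symm
      linarith
    · rw [htrA]; linarith
  · refine lt_of_le_of_ne ?_ hnonsing.symm
    -- The determinant is `det A + wᵀ adj(A) v`, and the adjugate of `A` is nonnegative.
    have hdet : (A + Matrix.vecMulVec v w).det = A.det + (v 0 * w 0 * (r - H 1 1)
        + v 1 * w 1 * (r - H 0 0) + v 0 * w 1 * H 1 0 + v 1 * w 0 * H 0 1) := by
      rw [hA, Matrix.det_fin_two, Matrix.det_fin_two]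
      simp [Matrix.vecMulVec_apply]
      ring
    rw [hdet, hsing, zero_add]
    have hvwn : ∀ i j, 0 ≤ v i * w j := fun i j => mul_nonneg (hv i) (hw j)
    have := mul_nonneg (hvwn 0 0) h1
    have := mul_nonneg (hvwn 1 1) h0
    have := mul_nonneg (hvwn 0 1) (hH 1 0)
    have := mul_nonneg (hvwn 1 0) (hH 0 1)
    linarith

/-! ### Normal matrices -/

theorem isStarNormal_complexMatrix {M : Matrix (Fin n) (Fin n) ℝ} (hM : IsStarNormal M) :
    IsStarNormal (complexMatrix M) := by
  have hstar : star (complexMatrix M) = complexMatrix (star M) := by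
    ext i j; simp [Matrix.star_apply]
  refine ⟨?_⟩
  rw [hstar]
  exact (hM.star_comm_self).map (Complex.ofRealHom.mapMatrix (m := Fin n))

section
open scoped Matrix.Norms.L2Operator

theorem norm_complexMatrix_eq_specRadius {M : Matrix (Fin n) (Fin n) ℝ} (hM : IsStarNormal M) :
    ‖complexMatrix M‖ = specRadius M := by
  have := isStarNormal_complexMatrix hM
  rw [specRadius, IsStarNormal.spectralRadius_eq_nnnorm (complexMatrix M)]
  simp

/-- The Euclidean operator norm of a normal matrix is its spectral radius, so Cauchy–Schwarz bounds
its quadratic form. -/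
theorem re_star_dotProduct_mulVec_le {M : Matrix (Fin n) (Fin n) ℝ} (hM : IsStarNormal M)
    (x : Fin n → ℂ) :
    (star x ⬝ᵥ (complexMatrix M *ᵥ x)).re ≤ specRadius M * (star x ⬝ᵥ x).re := by
  let X : EuclideanSpace ℂ (Fin n) := WithLp.toLp 2 x
  let Y : EuclideanSpace ℂ (Fin n) := WithLp.toLp 2 (complexMatrix M *ᵥ x)
  have h1 : star x ⬝ᵥ (complexMatrix M *ᵥ x) = inner ℂ X Y := by
    rw [EuclideanSpace.inner_eq_star_dotProduct, dotProduct_comm]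
  have h2 : (star x ⬝ᵥ x).re = ‖X‖ ^ 2 := by
    rw [dotProduct_comm, ← EuclideanSpace.inner_eq_star_dotProduct X X, inner_self_eq_norm_sq_to_K]
    norm_cast
  have h3 : ‖Y‖ ≤ specRadius M * ‖X‖ := by
    rw [← norm_complexMatrix_eq_specRadius hM]
    exact Matrix.l2_opNorm_mulVec (complexMatrix M) X
  rw [h1, h2]
  calc (inner ℂ X Y).re ≤ ‖X‖ * ‖Y‖ := re_inner_le_norm (𝕜 := ℂ) X Y
    _ ≤ ‖X‖ * (specRadius M * ‖X‖) := by gcongr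
    _ = specRadius M * ‖X‖ ^ 2 := by ring
end

/-! ### Symmetric matrices -/

/-- The spectral gap of a symmetric matrix: on the orthogonal complement of the kernel, the
quadratic form is bounded below by any lower bound `τ` of the nonzero eigenvalues. -/
theorem smul_dotProduct_self_le {A : Matrix (Fin n) (Fin n) ℝ} (hA : A.IsSymm) {τ : ℝ}
    (hτ : ∀ μ ∈ spectrum ℝ A, μ ≠ 0 → τ ≤ μ) {p : Fin n → ℝ}
    (hp : ∀ y, A *ᵥ y = 0 → y ⬝ᵥ p = 0) : τ * (p ⬝ᵥ p) ≤ p ⬝ᵥ (A *ᵥ p) := by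
  have hAh : A.IsHermitian := by
    rw [Matrix.IsHermitian, Matrix.conjTranspose_eq_transpose_of_trivial]; exact hA
  set b := hAh.eigenvectorBasis
  have hin : ∀ y q : Fin n → ℝ,
      inner ℝ (WithLp.toLp 2 y : EuclideanSpace ℝ (Fin n)) (WithLp.toLp 2 q) = y ⬝ᵥ q := fun y q => by
    rw [EuclideanSpace.inner_eq_star_dotProduct, dotProduct_comm]; simp
  have hsum : ∀ q : Fin n → ℝ, p ⬝ᵥ q = ∑ i, ((b i).ofLp ⬝ᵥ p) * ((b i).ofLp ⬝ᵥ q) := fun q => by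
    rw [← hin, ← b.sum_inner_mul_inner]
    refine Finset.sum_congr rfl fun i _ => ?_
    rw [real_inner_comm]
    exact congrArg₂ (· * ·) (hin _ _) (hin _ _)
  rw [hsum p, hsum (A *ᵥ p), Finset.mul_sum]
  refine Finset.sum_le_sum fun i _ => ?_
  have hbA : (b i).ofLp ⬝ᵥ (A *ᵥ p) = hAh.eigenvalues i * ((b i).ofLp ⬝ᵥ p) := by
    rw [Matrix.dotProduct_mulVec, ← Matrix.mulVec_transpose, hA.eq, hAh.mulVec_eigenvectorBasis,
      smul_dotProduct, smul_eq_mul]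
  rw [hbA]
  by_cases h0 : hAh.eigenvalues i = 0
  · have : (b i).ofLp ⬝ᵥ p = 0 := hp _ (by rw [hAh.mulVec_eigenvectorBasis, h0, zero_smul])
    simp [this]
  · have := hτ _ (hAh.eigenvalues_mem_spectrum_real i) h0
    nlinarith [mul_self_nonneg ((b i).ofLp ⬝ᵥ p)]

theorem dotProduct_self_sub (p q : Fin n → ℝ) :
    (p - q) ⬝ᵥ (p - q) = p ⬝ᵥ p - 2 * (p ⬝ᵥ q) + q ⬝ᵥ q := by
  simp only [sub_dotProduct, dotProduct_sub, dotProduct_comm q p]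
  ring

theorem zero_le_dotProduct_self (p : Fin n → ℝ) : 0 ≤ p ⬝ᵥ p :=
  Finset.sum_nonneg fun _ _ => mul_self_nonneg _

theorem sq_dotProduct_le (p q : Fin n → ℝ) : (p ⬝ᵥ q) ^ 2 ≤ (p ⬝ᵥ p) * (q ⬝ᵥ q) := by
  simpa [dotProduct, sq] using Finset.sum_mul_sq_le_sq_mul_sq Finset.univ p q

theorem sum_normSq_eq (y : Fin n → ℂ) :
    ∑ i, Complex.normSq (y i)
      = (fun i => (y i).re) ⬝ᵥ (fun i => (y i).re) + (fun i => (y i).im) ⬝ᵥ (fun i => (y i).im) := by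
  simp [dotProduct, Complex.normSq_apply, Finset.sum_add_distrib]

theorem normSq_complexVec_dotProduct_le (u : Fin n → ℝ) (y : Fin n → ℂ) :
    Complex.normSq (complexVec u ⬝ᵥ y) ≤ (u ⬝ᵥ u) * ∑ i, Complex.normSq (y i) := by
  have hre : (complexVec u ⬝ᵥ y).re = u ⬝ᵥ fun i => (y i).re := by
    simp [dotProduct, complexVec_apply]
  have him : (complexVec u ⬝ᵥ y).im = u ⬝ᵥ fun i => (y i).im := by
    simp [dotProduct, complexVec_apply]
  rw [Complex.normSq_apply, hre, him, sum_normSq_eq, mul_add, ← sq, ← sq]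
  exact add_le_add (sq_dotProduct_le _ _) (sq_dotProduct_le _ _)

/-- If `⟨A·,·⟩ ≥ τ‖·‖²` at the real and imaginary parts of `y`, then `‖(μ - A) y‖ ≥ |τ - μ| ‖y‖`
for `μ` in the closed left half-plane. -/
theorem normSq_sub_mul_sum_le {A : Matrix (Fin n) (Fin n) ℝ} (hA : A.IsSymm) {τ : ℝ} (hτ : 0 ≤ τ)
    {y : Fin n → ℂ}
    (hre : τ * ((fun i => (y i).re) ⬝ᵥ fun i => (y i).re)
      ≤ (fun i => (y i).re) ⬝ᵥ (A *ᵥ fun i => (y i).re))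
    (him : τ * ((fun i => (y i).im) ⬝ᵥ fun i => (y i).im)
      ≤ (fun i => (y i).im) ⬝ᵥ (A *ᵥ fun i => (y i).im))
    {μ : ℂ} (hμ : μ.re ≤ 0) :
    Complex.normSq (τ - μ) * ∑ i, Complex.normSq (y i)
      ≤ ∑ i, Complex.normSq ((μ • y - complexMatrix A *ᵥ y) i) := by
  set p : Fin n → ℝ := fun i => (y i).re with hp
  set q : Fin n → ℝ := fun i => (y i).im with hq
  have key : ∀ u : Fin n → ℝ, τ * (u ⬝ᵥ u) ≤ u ⬝ᵥ (A *ᵥ u) →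
      τ ^ 2 * (u ⬝ᵥ u) ≤ (A *ᵥ u) ⬝ᵥ (A *ᵥ u) := fun u hu => by
    have h := zero_le_dotProduct_self (A *ᵥ u - τ • u)
    rw [dotProduct_self_sub] at h
    simp only [dotProduct_smul, smul_dotProduct, smul_eq_mul, dotProduct_comm (A *ᵥ u) u] at h
    nlinarith [mul_le_mul_of_nonneg_left hu hτ]
  have hsymm : q ⬝ᵥ (A *ᵥ p) = p ⬝ᵥ (A *ᵥ q) := by
    rw [Matrix.dotProduct_mulVec, ← Matrix.mulVec_transpose, hA.eq, dotProduct_comm]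
  have e1 : (fun i => ((μ • y - complexMatrix A *ᵥ y) i).re)
      = μ.re • p - μ.im • q - A *ᵥ p := by
    funext i
    simp only [Pi.sub_apply, Complex.sub_re, complexMatrix_mulVec_re]
    simp [hp, hq]
  have e2 : (fun i => ((μ • y - complexMatrix A *ᵥ y) i).im)
      = μ.re • q + μ.im • p - A *ᵥ q := by
    funext i
    simp only [Pi.sub_apply, Complex.sub_im, complexMatrix_mulVec_im]
    simp [hp, hq]
  rw [sum_normSq_eq, sum_normSq_eq, e1, e2, ← hp, ← hq]
  simp only [sub_dotProduct, dotProduct_sub, add_dotProduct, dotProduct_add, smul_dotProduct,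
    dotProduct_smul, smul_eq_mul, dotProduct_comm q p, dotProduct_comm (A *ᵥ p) p,
    dotProduct_comm (A *ᵥ p) q, dotProduct_comm (A *ᵥ q) p, dotProduct_comm (A *ᵥ q) q, hsymm,
    Complex.normSq_apply, Complex.sub_re, Complex.sub_im, Complex.ofReal_re, Complex.ofReal_im]
  have k1 := key p hre
  have k2 := key q him
  have k3 := mul_le_mul_of_nonneg_left hre (neg_nonneg.2 hμ)
  have k4 := mul_le_mul_of_nonneg_left him (neg_nonneg.2 hμ)
  nlinarith [k1, k2, k3, k4]

/-- On the closed left half-plane `|μ - β| |τ - μ| / |μ|` is smallest on the imaginary axis, where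
it is at least `β + τ`. -/
theorem sq_add_mul_normSq_le {β τ : ℝ} (hβ : 0 ≤ β) (hτ : 0 ≤ τ) {μ : ℂ} (hμ : μ.re ≤ 0) :
    (β + τ) ^ 2 * Complex.normSq μ ≤ Complex.normSq (μ - β) * Complex.normSq (τ - μ) := by
  set m := Complex.normSq μ with hm
  have hm0 : 0 ≤ m := Complex.normSq_nonneg μ
  have e1 : β ^ 2 + m ≤ Complex.normSq (μ - β) := by
    simp only [hm, Complex.normSq_apply, Complex.sub_re, Complex.sub_im, Complex.ofReal_re,
      Complex.ofReal_im]
    nlinarith [mul_nonneg hβ (neg_nonneg.2 hμ)]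
  have e2 : τ ^ 2 + m ≤ Complex.normSq (τ - μ) := by
    simp only [hm, Complex.normSq_apply, Complex.sub_re, Complex.sub_im, Complex.ofReal_re,
      Complex.ofReal_im]
    nlinarith [mul_nonneg hτ (neg_nonneg.2 hμ)]
  calc (β + τ) ^ 2 * m ≤ (β ^ 2 + m) * (τ ^ 2 + m) := by nlinarith [sq_nonneg (β * τ - m)]
    _ ≤ _ := mul_le_mul e1 e2 (by positivity) (Complex.normSq_nonneg _)

theorem euclNorm_sq (x : Fin n → ℝ) : euclNorm x ^ 2 = x ⬝ᵥ x := by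
  rw [euclNorm, EuclideanSpace.real_norm_sq_eq]
  simp [dotProduct, sq]

theorem euclNorm_nonneg (x : Fin n → ℝ) : 0 ≤ euclNorm x := norm_nonneg _

/-- With `V = ‖v‖`, `W = ‖w‖`, `a = ⟨v, z⟩`, `c = ⟨w, z⟩` and `N = ‖z‖²`, the left side is the
product of the squared norms of the components of `v` and `w` orthogonal to `z`. -/
theorem sub_sq_mul_sub_sq_le {V W a c N : ℝ} (hN : 0 < N) :
    (V ^ 2 - a ^ 2 / N) * (W ^ 2 - c ^ 2 / N) ≤ (V * W - a * c / N) ^ 2 := by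
  have h : 0 ≤ (V * c - W * a) ^ 2 / N := by positivity
  have e : (V * W - a * c / N) ^ 2 - (V ^ 2 - a ^ 2 / N) * (W ^ 2 - c ^ 2 / N)
      = (V * c - W * a) ^ 2 / N := by
    field_simp
    ring
  linarith

theorem dotProduct_sub_smul_self (v z : Fin n → ℝ) (hz : z ⬝ᵥ z ≠ 0) :
    (v - ((v ⬝ᵥ z) / (z ⬝ᵥ z)) • z) ⬝ᵥ (v - ((v ⬝ᵥ z) / (z ⬝ᵥ z)) • z)
      = v ⬝ᵥ v - (v ⬝ᵥ z) ^ 2 / (z ⬝ᵥ z) := by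
  rw [dotProduct_self_sub]
  simp only [dotProduct_smul, smul_dotProduct, smul_eq_mul]
  field_simp
  ring

/-- An eigenvalue of `A + v wᵀ` in the closed left half-plane forces `τ ≤ ‖v‖‖w‖ - 2β` with
`β = ⟨v, z⟩⟨w, z⟩ / ‖z‖²`. Splitting the eigenvector as `x = ζ z + y` with `y ⊥ z` gives
`(μ - A) y = κ v'` and `κ (μ - β) = μ ⟨w', y⟩`, where `κ = wᵀx` and `v'`, `w'` are the components
of `v`, `w` orthogonal to `z`; eliminating `y` and `κ` yields
`|μ - β| |τ - μ| ≤ |μ| (‖v‖‖w‖ - β)`. -/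
theorem le_norm_mul_norm_sub_of_eigenvalue {A : Matrix (Fin n) (Fin n) ℝ} (hA : A.IsSymm)
    {z : Fin n → ℝ} (hz : z ≠ 0) (hAz : A *ᵥ z = 0)
    (hker : ∀ y, A *ᵥ y = 0 → ∃ c : ℝ, c • z = y) {τ : ℝ} (hτ0 : 0 ≤ τ)
    (hτ : ∀ μ ∈ spectrum ℝ A, μ ≠ 0 → τ ≤ μ) {v w : Fin n → ℝ}
    (hvw : 0 ≤ (v ⬝ᵥ z) * (w ⬝ᵥ z)) {μ : ℂ} {x : Fin n → ℂ} (hμ : μ.re ≤ 0) (hμ0 : μ ≠ 0)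
    (hκ : complexVec w ⬝ᵥ x ≠ 0)
    (hx : complexMatrix A *ᵥ x + (complexVec w ⬝ᵥ x) • complexVec v = μ • x) :
    τ ≤ euclNorm v * euclNorm w - 2 * ((v ⬝ᵥ z) * (w ⬝ᵥ z) / (z ⬝ᵥ z)) := by
  set a := v ⬝ᵥ z with ha
  set c := w ⬝ᵥ z with hc
  set N := z ⬝ᵥ z with hN
  set κ := complexVec w ⬝ᵥ x with hκdef
  have hN0 : 0 < N := (zero_le_dotProduct_self z).lt_of_ne' fun h => hz (dotProduct_self_eq_zero.1 h)
  have hNc : (N : ℂ) ≠ 0 := by exact_mod_cast hN0.ne'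
  set ζ : ℂ := (complexVec z ⬝ᵥ x) / N with hζ
  have hζN : ζ * N = complexVec z ⬝ᵥ x := by rw [hζ]; field_simp
  have hzA : z ᵥ* A = 0 := by rw [← Matrix.mulVec_transpose, hA.eq, hAz]
  have hzero : complexVec (0 : Fin n → ℝ) = 0 := by funext i; simp [complexVec_apply]
  -- Pairing the eigenvalue equation with `z` removes `A`.
  have hκa : κ * a = μ * (ζ * N) := by
    have h := congrArg (complexVec z ⬝ᵥ ·) hx
    simp only [dotProduct_add, complexVec_dotProduct_mulVec, hzA, hzero, zero_dotProduct,
      dotProduct_smul, complexVec_dotProduct, smul_eq_mul, zero_add] at h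
    rw [hζN, ← h, ha, dotProduct_comm]
  set y : Fin n → ℂ := x - ζ • complexVec z with hy
  set v' := v - (a / N) • z with hv'
  set w' := w - (c / N) • z with hw'
  have hzy : complexVec z ⬝ᵥ y = 0 := by
    rw [hy, dotProduct_sub, dotProduct_smul, complexVec_dotProduct, smul_eq_mul, ← hN, hζN,
      sub_self]
  have hcomp : μ • y - complexMatrix A *ᵥ y = κ • complexVec v' := by
    have hAy : complexMatrix A *ᵥ y = complexMatrix A *ᵥ x := by
      rw [hy, Matrix.mulVec_sub, Matrix.mulVec_smul, complexMatrix_mulVec_complexVec, hAz, hzero,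
        smul_zero, sub_zero]
    have hκa' : κ * (a / N) = μ * ζ := by
      rw [← mul_div_assoc, hκa]; field_simp
    rw [hAy]
    funext i
    have hi := congrFun hx i
    simp only [Pi.add_apply, Pi.smul_apply, smul_eq_mul, complexVec_apply] at hi
    simp only [hy, hv', Pi.sub_apply, Pi.smul_apply, smul_eq_mul, complexVec_apply]
    push_cast
    linear_combination -hi + hκa' * (z i : ℂ)
  have hw'y : κ * (μ - ((a * c / N : ℝ) : ℂ)) = μ * (complexVec w' ⬝ᵥ y) := by
    have e1 : complexVec w' = complexVec w - ((c / N : ℝ) : ℂ) • complexVec z := by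
      funext i; simp [complexVec_apply, hw']
    rw [e1, sub_dotProduct, smul_dotProduct, hzy, smul_zero, sub_zero, hy, dotProduct_sub,
      dotProduct_smul, complexVec_dotProduct, smul_eq_mul, ← hκdef, ← hc]
    have hκa' : κ * (a / N) = μ * ζ := by
      rw [← mul_div_assoc, hκa]; field_simp
    push_cast
    linear_combination -(c : ℂ) * hκa'
  -- The real and imaginary parts of `y` are orthogonal to the kernel of `A`.
  have hgap : ∀ p : Fin n → ℝ, z ⬝ᵥ p = 0 → τ * (p ⬝ᵥ p) ≤ p ⬝ᵥ (A *ᵥ p) := fun p hp =>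
    smul_dotProduct_self_le hA hτ fun u hu => by
      obtain ⟨k, rfl⟩ := hker u hu
      rw [smul_dotProduct, hp, smul_zero]
  have hlow := normSq_sub_mul_sum_le hA hτ0 (y := y)
    (hgap _ (by simpa [dotProduct, complexVec_apply] using congrArg Complex.re hzy))
    (hgap _ (by simpa [dotProduct, complexVec_apply] using congrArg Complex.im hzy)) hμ
  have hup : ∑ i, Complex.normSq ((κ • complexVec v') i) = Complex.normSq κ * (v' ⬝ᵥ v') := by
    simp [Complex.normSq_mul, complexVec_apply, dotProduct, Finset.mul_sum]
  rw [hcomp, hup] at hlow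
  have hcs := normSq_complexVec_dotProduct_le w' y
  have hsq := congrArg Complex.normSq hw'y
  rw [Complex.normSq_mul, Complex.normSq_mul] at hsq
  set β := a * c / N with hβ
  have hβ0 : 0 ≤ β := div_nonneg hvw hN0.le
  have hg : 0 < Complex.normSq κ := Complex.normSq_pos.2 hκ
  have hm : 0 < Complex.normSq μ := Complex.normSq_pos.2 hμ0
  set S := ∑ i, Complex.normSq (y i)
  have hw'0 := zero_le_dotProduct_self w'
  have hprod : Complex.normSq (μ - β) * Complex.normSq (τ - μ)
      ≤ Complex.normSq μ * ((v' ⬝ᵥ v') * (w' ⬝ᵥ w')) := by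
    refine le_of_mul_le_mul_left ?_ hg
    calc Complex.normSq κ * (Complex.normSq (μ - β) * Complex.normSq (τ - μ))
        = Complex.normSq μ * Complex.normSq (complexVec w' ⬝ᵥ y) * Complex.normSq (τ - μ) := by
          rw [← hsq]; ring
      _ ≤ Complex.normSq μ * ((w' ⬝ᵥ w') * S) * Complex.normSq (τ - μ) := by
          gcongr
          exact Complex.normSq_nonneg _
      _ = Complex.normSq μ * (w' ⬝ᵥ w') * (Complex.normSq (τ - μ) * S) := by ring
      _ ≤ Complex.normSq μ * (w' ⬝ᵥ w') * (Complex.normSq κ * (v' ⬝ᵥ v')) := by gcongr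
      _ = _ := by ring
  have hperp : (v' ⬝ᵥ v') * (w' ⬝ᵥ w') ≤ (euclNorm v * euclNorm w - β) ^ 2 := by
    rw [hv', hw', ha, hc, hN, dotProduct_sub_smul_self v z hN0.ne',
      dotProduct_sub_smul_self w z hN0.ne', ← euclNorm_sq v, ← euclNorm_sq w]
    exact sub_sq_mul_sub_sq_le hN0
  have hβs : β ≤ euclNorm v * euclNorm w := by
    rw [hβ, div_le_iff₀ hN0]
    refine abs_le_of_sq_le_sq' ?_ ?_ |>.2
    · calc (a * c) ^ 2 = a ^ 2 * c ^ 2 := by ring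
        _ ≤ ((v ⬝ᵥ v) * N) * ((w ⬝ᵥ w) * N) :=
          mul_le_mul (sq_dotProduct_le v z) (sq_dotProduct_le w z) (sq_nonneg _)
            (mul_nonneg (zero_le_dotProduct_self v) hN0.le)
        _ = (euclNorm v * euclNorm w * N) ^ 2 := by
          rw [← euclNorm_sq v, ← euclNorm_sq w]; ring
    · exact mul_nonneg (mul_nonneg (euclNorm_nonneg v) (euclNorm_nonneg w)) hN0.le
  have hfin : (β + τ) ^ 2 ≤ (euclNorm v * euclNorm w - β) ^ 2 := by
    refine le_of_mul_le_mul_right ?_ hm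
    refine (sq_add_mul_normSq_le hβ0 hτ0 hμ).trans (hprod.trans ?_)
    rw [mul_comm]
    gcongr
  have := (abs_le_of_sq_le_sq' hfin (sub_nonneg.2 hβs)).2
  linarith

/-- The bound `4 α (1 - 2α)² ≤ 1 - α` turns the smallness condition on `s = ‖v‖‖w‖` into
`τ > s (1 - 2α) = s - 2β`. -/
theorem sub_lt_of_half_lt_sqrt_mul {s β τ : ℝ} (hβ : 0 < β) (hs : 0 < s) (hτ : 0 < τ)
    (h : s / 2 < Real.sqrt (β / s / (1 - β / s)) * τ) : s - 2 * β < τ := by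
  by_contra! hle
  -- The negation and `τ > 0` force `α < 1 / 2`, so `1 - α` is a legitimate denominator.
  set α := β / s with hα
  have hβα : β = α * s := by rw [hα]; field_simp
  have hα0 : 0 < α := div_pos hβ hs
  have h2 : 0 < 1 - 2 * α := by
    rw [hβα] at hle
    by_contra! hneg
    nlinarith [mul_nonneg (neg_nonneg.2 hneg) hs.le]
  have h1 : 0 < 1 - α := by linarith
  have hsq : (s / 2) ^ 2 < α / (1 - α) * τ ^ 2 := by
    have := pow_lt_pow_left₀ h (by positivity) two_ne_zero
    rwa [mul_pow, Real.sq_sqrt (by positivity)] at this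
  have hτs : τ ^ 2 ≤ (s * (1 - 2 * α)) ^ 2 := by
    refine pow_le_pow_left₀ hτ.le ?_ 2
    rw [hβα] at hle
    linarith
  have h3 : (s / 2) ^ 2 < α / (1 - α) * (s * (1 - 2 * α)) ^ 2 := hsq.trans_le (by gcongr)
  have h4 : s ^ 2 * (1 - α) < s ^ 2 * (4 * α * (1 - 2 * α) ^ 2) := by
    rw [div_mul_eq_mul_div, lt_div_iff₀ h1] at h3
    nlinarith
  have h5 := lt_of_mul_lt_mul_left h4 (sq_nonneg s)
  nlinarith [mul_nonneg h2.le (sq_nonneg (4 * α - 1))]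

/-! ### Stability of the perturbation -/

theorem exists_norm_sub_diag_le_perturbed {H K : Matrix (Fin n) (Fin n) ℝ} {v w : Fin n → ℝ}
    (hK : ∀ i j, |H i j - v i * w j| ≤ K i j) {r : ℝ} {μ : ℂ} {x : Fin n → ℂ} (hx : x ≠ 0)
    (hBx : complexMatrix (r • (1 : Matrix (Fin n) (Fin n) ℝ) - H + Matrix.vecMulVec v w) *ᵥ x
      = μ • x) :
    ∃ i, ‖(r : ℂ) - μ - ((H i i - v i * w i : ℝ) : ℂ)‖ + K i i ≤ specRadius K := by
  refine exists_norm_sub_diag_le (C := H - Matrix.vecMulVec v w) hK hx ?_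
  rw [sub_add, complexMatrix_smul_one_sub_mulVec] at hBx
  rw [sub_smul, ← hBx, sub_sub_cancel]

theorem pos_of_mem_spectrum {H : Matrix (Fin n) (Fin n) ℝ} {τ : ℝ}
    (hτ : τ ∈ spectrum ℝ (specRadius H • (1 : Matrix (Fin n) (Fin n) ℝ) - H)) (hτ0 : τ ≠ 0) :
    0 < τ := by
  obtain ⟨y, hy, hAy⟩ := (mem_spectrum_iff_exists_mulVec _ _).1 hτ
  by_contra! hneg
  refine hτ0 ?_
  have hyc : complexVec y ≠ 0 := fun h => hy <| by
    funext i; simpa [complexVec_apply] using congrFun h i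
  have := eigenvalue_eq_zero_of_re_nonpos (H := H) (μ := (τ : ℂ)) hyc (by
    rw [complexMatrix_mulVec_complexVec, hAy]
    funext i; simp [complexVec_apply]) (by simpa using hneg)
  exact_mod_cast this

end RankOnePerturbation

open RankOnePerturbation in
theorem theorem2p7 (n : ℕ) (H A : Matrix (Fin n) (Fin n) ℝ)
    (hH : ∀ i j, 0 ≤ H i j)
    (hA : A = RankOnePerturbation.specRadius H • (1 : Matrix (Fin n) (Fin n) ℝ) - H)
    (hgeom : RankOnePerturbation.ZeroGeomSimple A)
    (zl zr : Fin n → ℝ) (hzl : zl ≠ 0) (hzlA : zl ᵥ* A = 0) (hzr : zr ≠ 0) (hAzr : A *ᵥ zr = 0)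
    (v w : Fin n → ℝ) (hnzp : (zl ⬝ᵥ v) * (w ⬝ᵥ zr) ≠ 0) :
    -- (i)
    (n = 2 → (∀ i, 0 ≤ v i) → (∀ i, 0 ≤ w i) →
      (RankOnePerturbation.ZeroAlgSimple A ∨ 0 < w ⬝ᵥ v) →
      RankOnePerturbation.StrictlyPositiveStable (A + Matrix.vecMulVec v w)) ∧
    -- (ii)
    ((A *ᵥ v = 0 ∨ w ᵥ* A = 0) → 0 < w ⬝ᵥ v →
      RankOnePerturbation.StrictlyPositiveStable (A + Matrix.vecMulVec v w)) ∧
    -- (iii)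
    (IsStarNormal A → w = v →
      RankOnePerturbation.StrictlyPositiveStable (A + Matrix.vecMulVec v w)) ∧
    -- (iv)
    ((∀ i, 0 < v i) → (∀ i, 0 < w i) → (∀ i j, v i * w j ≤ 2 * H i j) →
      RankOnePerturbation.StrictlyPositiveStable (A + Matrix.vecMulVec v w)) ∧
    -- (v)
    ((∃ K : Matrix (Fin n) (Fin n) ℝ, (∀ i j, 0 ≤ K i j) ∧
        (∀ i j, |H i j - v i * w j| ≤ K i j) ∧
        (∀ i, RankOnePerturbation.specRadius K + H i i
          < RankOnePerturbation.specRadius H + K i i + v i * w i)) →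
      RankOnePerturbation.StrictlyPositiveStable (A + Matrix.vecMulVec v w)) ∧
    -- (vi)
    (A.IsSymm → ∀ z : Fin n → ℝ, z ≠ 0 → A *ᵥ z = 0 →
      0 < (v ⬝ᵥ z) * (w ⬝ᵥ z) →
      ¬ (RankOnePerturbation.Parallel v z ∧ RankOnePerturbation.Parallel w z) →
      ∀ τ : ℝ, IsLeast {μ : ℝ | μ ∈ spectrum ℝ A ∧ μ ≠ 0} τ →
      RankOnePerturbation.euclNorm v * RankOnePerturbation.euclNorm w / 2
        < Real.sqrt (RankOnePerturbation.alpha v w z / (1 - RankOnePerturbation.alpha v w z)) * τ →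
      RankOnePerturbation.StrictlyPositiveStable (A + Matrix.vecMulVec v w)) := by
  have hnonsing : ∀ x : Fin n → ℂ, x ≠ 0 →
      complexMatrix A *ᵥ x + (complexVec w ⬝ᵥ x) • complexVec v ≠ 0 := fun x hx h =>
    hx (eq_zero_of_perturbed_mulVec_eq_zero hgeom hzlA hzr hAzr hnzp h)
  have heig : ∀ (μ : ℂ) (x : Fin n → ℂ), x ≠ 0 → complexMatrix A *ᵥ x = μ • x → μ.re ≤ 0 →
      μ = 0 := fun μ x hx hAx hre => by
    subst hA
    exact eigenvalue_eq_zero_of_re_nonpos hx hAx hre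
  -- It suffices to exclude nonzero eigenvalues in the closed left half-plane, and an eigenvector
  -- `x` for such an eigenvalue is not orthogonal to `w`, as it would be an eigenvector of `A`.
  have hstable : (∀ (μ : ℂ) (x : Fin n → ℂ), x ≠ 0 → μ ≠ 0 → μ.re ≤ 0 →
      complexVec w ⬝ᵥ x ≠ 0 →
      complexMatrix A *ᵥ x + (complexVec w ⬝ᵥ x) • complexVec v = μ • x → False) →
      StrictlyPositiveStable (A + Matrix.vecMulVec v w) := fun h => by
    refine strictlyPositiveStable_of_eigenvector fun μ x hx hBx => ?_
    rw [complexMatrix_add_vecMulVec_mulVec] at hBx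
    by_contra! hre
    have hμ0 : μ ≠ 0 := fun h0 => hnonsing x hx (by rw [hBx, h0, zero_smul])
    refine h μ x hx hμ0 hre (fun hwx => hμ0 (heig μ x hx ?_ hre)) hBx
    rwa [hwx, zero_smul, add_zero] at hBx
  refine ⟨?_, ?_, ?_, ?_, ?_, ?_⟩
  · intro hn hv hw hcase
    subst hn
    refine strictlyPositiveStable_fin_two_perturbed hH hA
      (Matrix.exists_mulVec_eq_zero_iff.1 ⟨zr, hzr, hAzr⟩) hv hw (fun hdet => ?_) hcase
    obtain ⟨y, hy, hBy⟩ := Matrix.exists_mulVec_eq_zero_iff.2 hdet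
    refine hnonsing (complexVec y) (fun h => hy ?_) ?_
    · funext i; simpa [complexVec_apply] using congrFun h i
    · rw [← complexMatrix_add_vecMulVec_mulVec, complexMatrix_mulVec_complexVec, hBy]
      funext i; simp [complexVec_apply]
  · rintro hcase hwv
    have hzero : complexVec (0 : Fin n → ℝ) = 0 := by funext i; simp [complexVec_apply]
    refine hstable fun μ x hx hμ0 hre hκ hBx => ?_
    -- In both cases the only other possible eigenvalue is `wᵀv`, which is positive.
    suffices hμ : μ = ((w ⬝ᵥ v : ℝ) : ℂ) by
      rw [hμ, Complex.ofReal_re] at hre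
      linarith
    rcases hcase with hAv | hwA
    · have hAAx : complexMatrix A *ᵥ (complexMatrix A *ᵥ x) = μ • (complexMatrix A *ᵥ x) := by
        have h := congrArg (complexMatrix A *ᵥ ·) hBx
        simpa only [Matrix.mulVec_add, Matrix.mulVec_smul, complexMatrix_mulVec_complexVec, hAv,
          hzero, smul_zero, add_zero] using h
      have hAx : complexMatrix A *ᵥ x = 0 := by
        by_contra h
        exact hμ0 (heig μ _ h hAAx hre)
      have h := congrArg (complexVec w ⬝ᵥ ·) hBx
      simp only [hAx, zero_add, dotProduct_smul, complexVec_dotProduct, smul_eq_mul] at h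
      rw [mul_comm] at h
      exact (mul_right_cancel₀ hκ h).symm
    · have h := congrArg (complexVec w ⬝ᵥ ·) hBx
      simp only [dotProduct_add, complexVec_dotProduct_mulVec, hwA, hzero, zero_dotProduct,
        zero_add, dotProduct_smul, complexVec_dotProduct, smul_eq_mul] at h
      rw [mul_comm] at h
      exact (mul_right_cancel₀ hκ h).symm
  · rintro hnormal rfl
    refine hstable fun μ x hx hμ0 hre hκ hBx => ?_
    have hHn : IsStarNormal H := by
      have hHA : H = specRadius H • (1 : Matrix (Fin n) (Fin n) ℝ) - A := by rw [hA]; simp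
      rw [hHA]
      refine ⟨?_⟩
      have hc := hnormal.star_comm_self
      rw [star_sub, star_smul, star_one]
      exact ((Commute.one_left _).smul_left _).sub_left
        (((Commute.one_right _).smul_right _).sub_right hc)
    have hq := re_star_dotProduct_mulVec_le hHn x
    have hHx : complexMatrix A *ᵥ x = (specRadius H : ℂ) • x - complexMatrix H *ᵥ x := by
      conv_lhs => rw [hA]
      exact complexMatrix_smul_one_sub_mulVec _ _ _
    -- The quadratic form of `w wᵀ` at `x` is `|wᵀx|²`.
    have hsw : star x ⬝ᵥ complexVec w = star (complexVec w ⬝ᵥ x) := by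
      simp [dotProduct, complexVec_apply, mul_comm]
    have h := congrArg (fun u => (star x ⬝ᵥ u).re) hBx
    rw [hHx] at h
    simp only [dotProduct_add, dotProduct_sub, dotProduct_smul, smul_eq_mul, hsw] at h
    have hxx : (star x ⬝ᵥ x).im = 0 := by
      simp [dotProduct, mul_comm]
    have hxx0 : 0 ≤ (star x ⬝ᵥ x).re := by
      simp only [dotProduct, Complex.re_sum]
      refine Finset.sum_nonneg fun i _ => ?_
      simpa using add_nonneg (mul_self_nonneg (x i).re) (mul_self_nonneg (x i).im)
    have hpos := Complex.normSq_pos.2 hκ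
    rw [Complex.normSq_apply] at hpos
    simp only [Complex.add_re, Complex.sub_re, Complex.mul_re, Complex.ofReal_re,
      Complex.ofReal_im, hxx, Complex.star_def, Complex.conj_re, Complex.conj_im] at h
    nlinarith [mul_nonneg (neg_nonneg.2 hre) hxx0]
  · intro hv hw hvw
    refine strictlyPositiveStable_of_eigenvector fun μ x hx hBx => ?_
    by_contra! hre
    have hμ0 : μ ≠ 0 := fun h0 => hnonsing x hx (by
      rw [← complexMatrix_add_vecMulVec_mulVec, hBx, h0, zero_smul])
    rw [hA] at hBx
    -- `H` itself dominates `H - v wᵀ` in modulus.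
    obtain ⟨i, hi⟩ := exists_norm_sub_diag_le_perturbed (K := H) (fun i j => by
      have := mul_pos (hv i) (hw j)
      rw [abs_le]
      constructor <;> linarith [hvw i j]) hx hBx
    refine hμ0 (eq_zero_of_norm_sub_le (specRadius_nonneg H) ?_ hre)
    have hnorm : ‖((H i i - v i * w i : ℝ) : ℂ)‖ ≤ H i i := by
      rw [Complex.norm_real, Real.norm_eq_abs, abs_le]
      have := mul_pos (hv i) (hw i)
      constructor <;> linarith [hvw i i]
    linarith [norm_le_norm_add_norm_sub' ((specRadius H : ℂ) - μ) ((H i i - v i * w i : ℝ) : ℂ)]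
  · rintro ⟨K, -, hHK, hK⟩
    refine strictlyPositiveStable_of_eigenvector fun μ x hx hBx => ?_
    rw [hA] at hBx
    obtain ⟨i, hi⟩ := exists_norm_sub_diag_le_perturbed hHK hx hBx
    have hre := (Complex.re_le_norm _).trans (le_sub_iff_add_le.2 hi)
    simp only [Complex.sub_re, Complex.ofReal_re] at hre
    linarith [hK i]
  · intro hsymm z hz hAz hpos _ τ hτ hsmall
    refine hstable fun μ x hx hμ0 hre hκ hBx => ?_
    have hτ0 : 0 < τ := pos_of_mem_spectrum (H := H) (hA ▸ hτ.1.1) hτ.1.2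
    have hbound := le_norm_mul_norm_sub_of_eigenvalue hsymm hz hAz
      (fun y hy => exists_smul_eq_of_mulVec_eq_zero hgeom hz hAz hy) hτ0.le
      (fun ν hν hν0 => hτ.2 ⟨hν, hν0⟩) hpos.le hre hμ0 hκ hBx
    have hzz : 0 < z ⬝ᵥ z :=
      (zero_le_dotProduct_self z).lt_of_ne' fun h => hz (dotProduct_self_eq_zero.1 h)
    have hs : 0 < euclNorm v * euclNorm w := by
      have : 0 ≤ euclNorm v * euclNorm w := mul_nonneg (euclNorm_nonneg v) (euclNorm_nonneg w)
      have := div_pos hpos hzz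
      linarith
    refine hbound.not_gt (sub_lt_of_half_lt_sqrt_mul (div_pos hpos hzz) hs hτ0 ?_)
    have hα : alpha v w z
        = (v ⬝ᵥ z) * (w ⬝ᵥ z) / (z ⬝ᵥ z) / (euclNorm v * euclNorm w) := by
      rw [alpha, abs_of_pos hpos, euclNorm_sq, div_div, mul_comm (z ⬝ᵥ z)]
    rwa [hα] at hsmall
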